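/- A function $h\colon \mathbb C\setminus\mathbb R\to\mathbb C$ is called a Herglotz function if it is holomorphic and satisfies $\operatorname{Im} h(z)/\operatorname{Im} z\ge 0$ and $\overline{h(z)}=h(\overline z)$ for all $z\in\mathbb C\setminus\mathbb R$. A function $q\colon \mathbb C\setminus\mathbb R\to\mathbb C$ is called quasi-Herglotz if there exist Herglotz functions $h_1,h_2,h_3,h_4$ such that $q=(h_1-h_2)+i\,(h_3-h_4)$ on $\mathbb C\setminus\mathbb R$. Theorem. Let $q\colon\mathbb C\setminus\mathbb R\to\mathbb C$ be a holomorphic function. Then $q$ is a quasi-Herglotz function if and only if it satisfies both of the following conditions: (1) (growth condition) there exists a number $M\ge 0$ such that $$|q(z)|\le M\,\frac{1+|z|^2}{|\operatorname{Im} z|}\qquad\text{for all } z\in\mathbb C\setminus\mathbb R;$$ (2) (regularity condition) $$\sup_{r\in(0,1)}\int_{\mathbb R}\bigl|q(t+ir)-q(t-ir)\bigr|\,\frac{dt}{1+t^2}<\infty .$$ -/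

import Mathlib

open scoped ENNReal ComplexConjugate

/-- The domain `ℂ ∖ ℝ`. A function on `ℂ ∖ ℝ` is modelled by a total function `ℂ → ℂ` of which
only the values on this set are ever used. -/
def nonRealPlane : Set ℂ := {z : ℂ | z.im ≠ 0}

/-- Herglotz functions on `ℂ ∖ ℝ`. -/
structure IsHerglotz (h : ℂ → ℂ) : Prop where
  holomorphic : DifferentiableOn ℂ h nonRealPlane
  im_div_im_nonneg : ∀ z ∈ nonRealPlane, 0 ≤ (h z).im / z.im
  conj_symm : ∀ z ∈ nonRealPlane, conj (h z) = h (conj z)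

/-- Quasi-Herglotz functions on `ℂ ∖ ℝ`. -/
def IsQuasiHerglotz (q : ℂ → ℂ) : Prop :=
  ∃ h₁ h₂ h₃ h₄ : ℂ → ℂ, IsHerglotz h₁ ∧ IsHerglotz h₂ ∧ IsHerglotz h₃ ∧ IsHerglotz h₄ ∧
    ∀ z ∈ nonRealPlane, q z = (h₁ z - h₂ z) + Complex.I * (h₃ z - h₄ z)

open Filter Topology MeasureTheory Complex
open scoped BoundedContinuousFunction

/-! Necessity. Both conditions pass to linear combinations, so a single Herglotz function `h`
suffices. Growth is Borel–Carathéodory transported to the half-plane by the Cayley map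
(`norm_le_of_im_nonneg`). For regularity, symmetry turns the jump at height r into 2i Im h(t+ir).
This has constant sign, so its weighted integral is at most 2π Im h(i+ir) by the Poisson formula at
i (`lintegral_im_le`), which the growth bound controls uniformly in r.

Sufficiency. For fixed r, shift `q` by ir away from the real line and subtract the affine function
that agrees with the result at ±i. Division by 1+t² then creates no poles, and growth lets Cauchy's
formula close at infinity in each half-plane. Adding the two formulas expresses the shifted `q` as
an affine function plus an integral against the jump density (`exists_shift_representation`).
Regularity bounds these densities in L¹ uniformly in r. Their four positive parts therefore have
weak-* limits along an ultrafilter r → 0+ (`exists_tendsto_weight`).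

The limits are taken in the dual of all bounded continuous functions on ℝ, so mass escaping to
infinity is kept and no limiting measure has to be constructed. A positive functional applied to the
kernel (1+tz)/(t-z) is Herglotz, and what remains is a limit of affine functions, hence affine
(`eq_affine_of_tendsto`). -/

/-! ### Cauchy integrals over the real line -/

/-- Cauchy's theorem on a rectangle of half-width W = s³ and height H = s². The top contributes
O(W/H²) and the sides O(H/W), so any choice with H ≪ W ≪ H² works. -/
theorem norm_integral_upper_le_of_bound {F : ℂ → ℂ} {δ ρ C s : ℝ} (hδ : 0 < δ) (hρ : 0 < ρ)
    (hF : DifferentiableOn ℂ F {t | -δ < t.im}) (hC : 0 ≤ C) (hs : 1 ≤ s)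
    (hb : ∀ t : ℂ, 0 ≤ t.im → s ^ 2 ≤ ‖t‖ → ‖F t‖ ≤ C / (‖t‖ * (ρ + t.im))) :
    ‖∫ t in (-s ^ 3)..(s ^ 3), F (t : ℂ)‖ ≤ (2 * C + 2 * (C / ρ)) / s := by
  have hs0 : 0 < s := by linarith
  have h23 : s ^ 2 ≤ s ^ 3 := pow_le_pow_right₀ hs (by norm_num)
  have key := integral_boundary_rect_eq_zero_of_differentiableOn F
    ((-s ^ 3 : ℝ) : ℂ) ((s ^ 3 : ℝ) + (s ^ 2 : ℝ) * I) (hF.mono (by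
      intro t ht
      have h2 := ht.2
      simp only [Set.mem_preimage, ofReal_im, add_im, mul_im, ofReal_re, I_im, I_re, mul_one,
        mul_zero, add_zero, zero_add, Set.mem_uIcc] at h2
      have : 0 ≤ s ^ 2 := by positivity
      show -δ < t.im
      rcases h2 with h | h <;> linarith))
  simp only [ofReal_im, add_im, mul_im, ofReal_re, I_im, I_re, mul_one, add_re, mul_re,
    mul_zero, add_zero, zero_add, sub_zero, ofReal_zero, zero_mul] at key
  have htop : ‖∫ x : ℝ in (-s ^ 3)..(s ^ 3), F (x + (s ^ 2 : ℝ) * I)‖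
      ≤ C / (s ^ 2 * s ^ 2) * |s ^ 3 - -s ^ 3| := by
    refine intervalIntegral.norm_integral_le_of_norm_le_const fun x _ => ?_
    have him : ((x : ℂ) + (s ^ 2 : ℝ) * I).im = s ^ 2 := by simp [-ofReal_pow]
    have hn : s ^ 2 ≤ ‖(x : ℂ) + (s ^ 2 : ℝ) * I‖ := by
      have := Complex.abs_im_le_norm ((x : ℂ) + (s ^ 2 : ℝ) * I)
      rw [him, abs_of_nonneg (by positivity)] at this
      exact this
    refine (hb _ (by rw [him]; positivity) hn).trans ?_
    rw [him]
    gcongr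
    linarith
  have hside : ∀ a : ℝ, |a| = s ^ 3 → ‖∫ y : ℝ in (0 : ℝ)..(s ^ 2), F ((a : ℝ) + y * I)‖
      ≤ C / (s ^ 3 * ρ) * |s ^ 2 - 0| := by
    intro a ha
    refine intervalIntegral.norm_integral_le_of_norm_le_const fun y hy => ?_
    rw [Set.uIoc_of_le (by positivity)] at hy
    have him : ((a : ℂ) + y * I).im = y := by simp
    have hn : s ^ 3 ≤ ‖(a : ℂ) + y * I‖ := by
      have := Complex.abs_re_le_norm ((a : ℂ) + y * I)
      simpa [ha] using this
    refine (hb _ (by rw [him]; exact hy.1.le) (h23.trans hn)).trans ?_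
    rw [him]
    have := hy.1
    gcongr
    linarith
  have e : ∫ t in (-s ^ 3)..(s ^ 3), F (t : ℂ) =
      (∫ x : ℝ in (-s ^ 3)..(s ^ 3), F (x + (s ^ 2 : ℝ) * I))
      - I • (∫ y : ℝ in (0 : ℝ)..(s ^ 2), F ((s ^ 3 : ℝ) + y * I))
      + I • (∫ y : ℝ in (0 : ℝ)..(s ^ 2), F ((-s ^ 3 : ℝ) + y * I)) := by
    linear_combination key
  rw [e]
  refine (norm_add_le _ _).trans ((add_le_add_left (norm_sub_le _ _) _).trans ?_)
  rw [norm_smul, norm_smul, norm_I, one_mul, one_mul]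
  refine (add_le_add (add_le_add htop (hside _ (abs_of_pos (by positivity))))
    (hside _ (by rw [abs_neg, abs_of_pos (by positivity)]))).trans (le_of_eq ?_)
  rw [abs_of_pos (by linarith [pow_pos hs0 3]), abs_of_pos (by linarith [pow_pos hs0 2])]
  field_simp
  ring

theorem tendsto_integral_upper_zero {F : ℂ → ℂ} {δ ρ C R₀ : ℝ} (hδ : 0 < δ) (hρ : 0 < ρ)
    (hF : DifferentiableOn ℂ F {t | -δ < t.im}) (hC : 0 ≤ C)
    (hb : ∀ t : ℂ, 0 ≤ t.im → R₀ ≤ ‖t‖ → ‖F t‖ ≤ C / (‖t‖ * (ρ + t.im))) :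
    Tendsto (fun s : ℝ => ∫ t in (-s ^ 3)..(s ^ 3), F (t : ℂ)) atTop (𝓝 0) := by
  have h0 : Tendsto (fun s : ℝ => (2 * C + 2 * (C / ρ)) / s) atTop (𝓝 0) :=
    tendsto_const_nhds.div_atTop tendsto_id
  refine squeeze_zero_norm' ?_ h0
  filter_upwards [eventually_ge_atTop 1, eventually_ge_atTop R₀] with s h1 h2
  refine norm_integral_upper_le_of_bound hδ hρ hF hC h1 fun t ht hst => hb t ht ?_
  nlinarith

/-- The integrand is 2i Im z/|t-z|², with primitive 2i arctan((t - Re z)/Im z). -/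
theorem tendsto_integral_poisson {z : ℂ} (hz : 0 < z.im) :
    Tendsto (fun R : ℝ => ∫ t in (-R)..R, (1 / ((t : ℂ) - z) - 1 / ((t : ℂ) - conj z))) atTop
      (𝓝 (2 * Real.pi * I)) := by
  have hderiv : ∀ t : ℝ, HasDerivAt (fun t : ℝ => 2 * Real.arctan ((t - z.re) / z.im))
      (2 * (z.im / ((t - z.re) ^ 2 + z.im ^ 2))) t := by
    intro t
    have h1 : HasDerivAt (fun t : ℝ => (t - z.re) / z.im) (1 / z.im) t :=
      ((hasDerivAt_id t).sub_const _).div_const _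
    refine ((h1.arctan).const_mul 2).congr_deriv ?_
    have : (t - z.re) ^ 2 + z.im ^ 2 ≠ 0 := by positivity
    field_simp
    ring
  have hpt : ∀ t : ℝ, (1 / ((t : ℂ) - z) - 1 / ((t : ℂ) - conj z)) =
      ((2 * (z.im / ((t - z.re) ^ 2 + z.im ^ 2)) : ℝ) : ℂ) * I := by
    intro t
    have h1 : (t : ℂ) - z ≠ 0 := fun h => hz.ne' (by simpa using congrArg im h)
    have h2 : (t : ℂ) - conj z ≠ 0 := fun h => hz.ne' (by simpa using congrArg im h)
    have h3 : ((t : ℂ) - z) * ((t : ℂ) - conj z) = (((t - z.re) ^ 2 + z.im ^ 2 : ℝ) : ℂ) := by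
      apply Complex.ext <;> simp [pow_two]
      ring
    have h4 : z - conj z = 2 * z.im * I := by
      apply Complex.ext <;> simp
      ring
    rw [div_sub_div _ _ h1 h2, h3]
    push_cast
    linear_combination (1 / ((((t:ℂ) - z.re) ^ 2 + z.im ^ 2))) * h4
  have hint : ∀ R : ℝ, ∫ t in (-R)..R, (1 / ((t : ℂ) - z) - 1 / ((t : ℂ) - conj z)) =
      ((2 * Real.arctan ((R - z.re) / z.im) - 2 * Real.arctan ((-R - z.re) / z.im) : ℝ) : ℂ) * I := by
    intro R
    simp_rw [hpt]
    rw [intervalIntegral.integral_mul_const, intervalIntegral.integral_ofReal,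
      intervalIntegral.integral_eq_sub_of_hasDerivAt (fun t _ => hderiv t)]
    refine Continuous.intervalIntegrable ?_ _ _
    refine continuous_const.mul (continuous_const.div (by fun_prop) fun t => ?_)
    positivity
  simp_rw [hint]
  have ha : Tendsto (fun R : ℝ => (R - z.re) / z.im) atTop atTop :=
    (tendsto_atTop_add_const_right _ _ tendsto_id).atTop_div_const hz
  have hb : Tendsto (fun R : ℝ => (-R - z.re) / z.im) atTop atBot := by
    refine Tendsto.atBot_div_const hz ?_
    exact tendsto_atBot_add_const_right _ _ tendsto_neg_atTop_atBot
  have ha' := (tendsto_nhds_of_tendsto_nhdsWithin (Real.tendsto_arctan_atTop.comp ha)).const_mul 2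
  have hb' := (tendsto_nhds_of_tendsto_nhdsWithin (Real.tendsto_arctan_atBot.comp hb)).const_mul 2
  have := ((continuous_ofReal.tendsto _).comp (ha'.sub hb')).mul_const I
  convert this using 2
  · rfl
  · push_cast
    ring

theorem half_norm_le_norm_sub {t z : ℂ} (h : 2 * ‖z‖ ≤ ‖t‖) : ‖t‖ / 2 ≤ ‖t - z‖ := by
  have := norm_sub_norm_le t z
  linarith

theorem tendsto_cauchy_integral_upper_of_im_neg {g : ℂ → ℂ} {δ ρ C R₀ : ℝ} (hδ : 0 < δ)
    (hρ : 0 < ρ) (hC : 0 ≤ C) (hg : DifferentiableOn ℂ g {t | -δ < t.im})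
    (hb : ∀ t : ℂ, 0 ≤ t.im → R₀ ≤ ‖t‖ → ‖g t‖ ≤ C / (ρ + t.im)) {z : ℂ} (hz : z.im < 0) :
    Tendsto (fun s : ℝ => ∫ t in (-s ^ 3)..(s ^ 3), g t / ((t : ℂ) - z)) atTop (𝓝 0) := by
  have hδ' : 0 < min δ (-z.im) := lt_min hδ (by linarith)
  refine tendsto_integral_upper_zero (F := fun t => g t / (t - z)) (R₀ := max R₀ (2 * ‖z‖))
    (C := 2 * C) hδ' hρ ?_ (by positivity) ?_
  · refine DifferentiableOn.div (hg.mono fun t ht => ?_) (by fun_prop) fun t ht h => ?_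
    · have h1 : -min δ (-z.im) < t.im := ht
      exact lt_of_le_of_lt (neg_le_neg (min_le_left _ _)) h1
    · have h1 : -min δ (-z.im) < t.im := ht
      rw [sub_eq_zero.1 h] at h1
      linarith [min_le_right δ (-z.im)]
  · intro t ht hR
    have h1 := half_norm_le_norm_sub ((le_max_right _ _).trans hR)
    have hz0 : 0 < ‖z‖ := norm_pos_iff.2 fun h => hz.ne (by simp [h])
    have h2 : 0 < ‖t‖ := by linarith [(le_max_right R₀ (2 * ‖z‖)).trans hR]
    rw [norm_div]
    calc ‖g t‖ / ‖t - z‖ ≤ (C / (ρ + t.im)) / (‖t‖ / 2) := by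
          gcongr
          exact hb t ht ((le_max_left _ _).trans hR)
      _ = _ := by field_simp

/-- Subtracting g(z) times the Poisson-type kernel 1/(t-z) - 1/(t-z̄) removes the pole at z without
spoiling the decay. The remainder integrates to 0 and the kernel to 2πi. -/
theorem tendsto_cauchy_integral_upper_of_im_pos {g : ℂ → ℂ} {δ ρ C R₀ : ℝ} (hδ : 0 < δ)
    (hρ : 0 < ρ) (hC : 0 ≤ C) (hg : DifferentiableOn ℂ g {t | -δ < t.im})
    (hb : ∀ t : ℂ, 0 ≤ t.im → R₀ ≤ ‖t‖ → ‖g t‖ ≤ C / (ρ + t.im)) {z : ℂ} (hz : 0 < z.im) :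
    Tendsto (fun s : ℝ => ∫ t in (-s ^ 3)..(s ^ 3), g t / ((t : ℂ) - z)) atTop
      (𝓝 (2 * Real.pi * I * g z)) := by
  have hδ' : 0 < min δ z.im := lt_min hδ hz
  have hopen : IsOpen {t : ℂ | -min δ z.im < t.im} := isOpen_lt continuous_const continuous_im
  have hmem : z ∈ {t : ℂ | -min δ z.im < t.im} := by
    show -min δ z.im < z.im
    linarith
  have hdom : {t : ℂ | -min δ z.im < t.im} ⊆ {t : ℂ | -δ < t.im} := fun t ht => by
    have h1 : -min δ z.im < t.im := ht
    exact lt_of_le_of_lt (neg_le_neg (min_le_left δ z.im)) h1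
  have hne : ∀ t ∈ {t : ℂ | -min δ z.im < t.im}, t - conj z ≠ 0 := fun t ht h => by
    have h1 : -min δ z.im < t.im := ht
    rw [sub_eq_zero.1 h, conj_im] at h1
    linarith [min_le_right δ z.im]
  have hreal : ∀ t : ℝ, (t : ℂ) ≠ z := fun t h => hz.ne (by simpa using congrArg im h)
  have hrm : ∀ t : ℝ, (t : ℂ) ∈ {t : ℂ | -min δ z.im < t.im} := fun t => by
    show -min δ z.im < (t : ℂ).im
    rw [ofReal_im]; linarith
  have hF : Tendsto (fun s : ℝ => ∫ t in (-s ^ 3)..(s ^ 3),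
      (dslope g z t + g z / ((t : ℂ) - conj z))) atTop (𝓝 0) := by
    -- The constant uses |t-z|, |t-z̄| ≥ |t|/2, and ρ + Im t ≤ (ρ+1)|t| for |t| ≥ 1.
    refine tendsto_integral_upper_zero (F := fun t => dslope g z t + g z / (t - conj z))
      (R₀ := max R₀ (max 1 (2 * ‖z‖))) (C := 2 * C + 8 * (‖g z‖ * z.im * (ρ + 1))) hδ' hρ ?_
      (by positivity) ?_
    · refine DifferentiableOn.add ?_ ?_
      · exact (differentiableOn_dslope (hopen.mem_nhds hmem)).2 (hg.mono hdom)
      · exact DifferentiableOn.div (by fun_prop) (by fun_prop) hne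
    · intro t ht hR
      have hR1 : R₀ ≤ ‖t‖ := (le_max_left _ _).trans hR
      have hR2 : 1 ≤ ‖t‖ := (le_max_left _ _).trans ((le_max_right _ _).trans hR)
      have hR3 : 2 * ‖z‖ ≤ ‖t‖ := (le_max_right _ _).trans ((le_max_right _ _).trans hR)
      have h1 := half_norm_le_norm_sub hR3
      have h2 : ‖t‖ / 2 ≤ ‖t - conj z‖ := half_norm_le_norm_sub (by simpa using hR3)
      have ht0 : 0 < ‖t‖ := by linarith
      have hne1 : t - z ≠ 0 := norm_pos_iff.1 (by linarith)
      have hne2 : t - conj z ≠ 0 := norm_pos_iff.1 (by linarith)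
      have h4 : z - conj z = 2 * z.im * I := by
        apply Complex.ext <;> simp; ring
      have e : dslope g z t + g z / (t - conj z) =
          g t / (t - z) - g z * (2 * z.im * I) / ((t - z) * (t - conj z)) := by
        rw [dslope_of_ne _ (sub_ne_zero.1 hne1), slope_def_field, ← h4]
        field_simp
        ring
      have him : t.im ≤ ‖t‖ := (le_abs_self _).trans (abs_im_le_norm t)
      have h5 : ρ + t.im ≤ (ρ + 1) * ‖t‖ := by nlinarith
      rw [e]
      refine (norm_sub_le _ _).trans ?_
      have hA : ‖g t / (t - z)‖ ≤ 2 * C / (‖t‖ * (ρ + t.im)) := by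
        rw [norm_div]
        calc ‖g t‖ / ‖t - z‖ ≤ (C / (ρ + t.im)) / (‖t‖ / 2) := by
              gcongr
              exact hb t ht hR1
          _ = _ := by field_simp
      have hB : ‖g z * (2 * z.im * I) / ((t - z) * (t - conj z))‖ ≤
          8 * (‖g z‖ * z.im * (ρ + 1)) / (‖t‖ * (ρ + t.im)) := by
        have : ‖g z * (2 * z.im * I)‖ = ‖g z‖ * (2 * z.im) := by
          simp [abs_of_pos hz]
        rw [norm_div, this, norm_mul]
        calc ‖g z‖ * (2 * z.im) / (‖t - z‖ * ‖t - conj z‖)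
            ≤ ‖g z‖ * (2 * z.im) / ((‖t‖ / 2) * (‖t‖ / 2)) := by gcongr
          _ = 8 * (‖g z‖ * z.im * (ρ + 1)) / (‖t‖ * ((ρ + 1) * ‖t‖)) := by
              field_simp; ring
          _ ≤ _ := by gcongr
      calc _ ≤ _ := add_le_add hA hB
        _ = _ := by ring
  have hP := ((tendsto_integral_poisson hz).comp
    (tendsto_pow_atTop (α := ℝ) (n := 3) (by norm_num))).const_mul (g z)
  have hsum := hF.add hP
  rw [zero_add, mul_comm (g z)] at hsum
  refine hsum.congr fun s => ?_
  simp only [Function.comp]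
  have c1 : Continuous fun t : ℝ => dslope g z t + g z / ((t : ℂ) - conj z) := by
    refine Continuous.add ?_ (continuous_const.div (by fun_prop) fun t => hne _ (hrm t))
    have := ((differentiableOn_dslope (hopen.mem_nhds hmem)).2 (hg.mono hdom)).continuousOn
    exact this.comp_continuous continuous_ofReal hrm
  have c2 : Continuous fun t : ℝ => 1 / ((t : ℂ) - z) - 1 / ((t : ℂ) - conj z) :=
    (continuous_const.div (by fun_prop) fun t => sub_ne_zero.2 (hreal t)).sub
      (continuous_const.div (by fun_prop) fun t => hne _ (hrm t))
  have c3 : Continuous fun t : ℝ => g z * (1 / ((t : ℂ) - z) - 1 / ((t : ℂ) - conj z)) :=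
    continuous_const.mul c2
  rw [← intervalIntegral.integral_const_mul, ← intervalIntegral.integral_add
    (c1.intervalIntegrable _ _) (c3.intervalIntegrable _ _)]
  refine intervalIntegral.integral_congr fun t _ => ?_
  have hne1 := sub_ne_zero.2 (hreal t)
  have hne2 := hne _ (hrm t)
  rw [dslope_of_ne _ (hreal t), slope_def_field]
  field_simp
  ring

/-! ### The resolvent and Herglotz kernels as bounded continuous functions -/

theorem norm_inv_ofReal_sub_le {z : ℂ} (hz : z.im ≠ 0) (t : ℝ) :
    ‖((t : ℂ) - z)⁻¹‖ ≤ |z.im|⁻¹ := by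
  rw [norm_inv]
  have := abs_im_le_norm ((t : ℂ) - z)
  simp only [sub_im, ofReal_im, zero_sub, abs_neg] at this
  exact inv_anti₀ (abs_pos.2 hz) this

theorem ofReal_sub_ne_zero {z : ℂ} (hz : z.im ≠ 0) (t : ℝ) : (t : ℂ) - z ≠ 0 :=
  fun h => hz (by simpa using congrArg im h)

open Classical in
/-- The function `t ↦ 1 / (t - z)` on the real line as a bounded continuous function
(zero for real `z`). -/
noncomputable def resolventBCF (z : ℂ) : ℝ →ᵇ ℂ :=
  if hz : z.im ≠ 0 then
    BoundedContinuousFunction.ofNormedAddCommGroup (fun t : ℝ => ((t : ℂ) - z)⁻¹)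
      (Continuous.inv₀ (by fun_prop) (ofReal_sub_ne_zero hz)) |z.im|⁻¹ (norm_inv_ofReal_sub_le hz)
  else 0

theorem resolventBCF_apply {z : ℂ} (hz : z.im ≠ 0) (t : ℝ) :
    resolventBCF z t = ((t : ℂ) - z)⁻¹ := by
  rw [resolventBCF, dif_pos hz]; rfl

theorem norm_resolventBCF_le (z : ℂ) : ‖resolventBCF z‖ ≤ |z.im|⁻¹ := by
  by_cases hz : z.im = 0
  · rw [resolventBCF, dif_neg (not_not.2 hz)]; simp
  · refine (BoundedContinuousFunction.norm_le (by positivity)).2 fun t => ?_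
    rw [resolventBCF_apply hz]
    exact norm_inv_ofReal_sub_le hz t

theorem resolventBCF_taylor {z w : ℂ} (hz : z.im ≠ 0) (hw : w.im ≠ 0) :
    resolventBCF z - resolventBCF w - (z - w) • (resolventBCF w * resolventBCF w) =
      (z - w) ^ 2 • (resolventBCF z * (resolventBCF w * resolventBCF w)) := by
  ext t
  have h1 := ofReal_sub_ne_zero hz t
  have h2 := ofReal_sub_ne_zero hw t
  simp only [BoundedContinuousFunction.sub_apply, BoundedContinuousFunction.smul_apply,
    BoundedContinuousFunction.mul_apply, resolventBCF_apply hz, resolventBCF_apply hw, smul_eq_mul]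
  field_simp
  ring

/-- Differentiability holds in sup norm, so every continuous functional of the resolvent is
holomorphic in z. The exact second-order remainder is uniformly controlled while |Im z| > |Im w|/2.
-/
theorem hasDerivAt_resolventBCF {w : ℂ} (hw : w.im ≠ 0) :
    HasDerivAt resolventBCF (resolventBCF w * resolventBCF w) w := by
  rw [hasDerivAt_iff_isLittleO]
  have hev : ∀ᶠ z : ℂ in 𝓝 w, |w.im| / 2 < |z.im| :=
    (continuous_im.abs.tendsto w).eventually (lt_mem_nhds (half_lt_self (abs_pos.2 hw)))
  have hO : (fun z => resolventBCF z - resolventBCF w - (z - w) • (resolventBCF w * resolventBCF w))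
      =O[𝓝 w] fun z => (z - w) ^ 2 := by
    refine Asymptotics.IsBigO.of_bound ((|w.im| / 2)⁻¹ * ‖resolventBCF w * resolventBCF w‖) ?_
    filter_upwards [hev] with z hz
    have hw0 := abs_pos.2 hw
    have hz0 : z.im ≠ 0 := abs_pos.1 (by linarith)
    rw [resolventBCF_taylor hz0 hw, norm_smul, mul_comm]
    gcongr
    refine (norm_mul_le _ _).trans ?_
    gcongr
    refine (norm_resolventBCF_le z).trans ?_
    gcongr
  refine hO.trans_isLittleO ?_
  simpa [Function.comp_def] using ((Asymptotics.isLittleO_pow_pow (𝕜 := ℂ) (show 1 < 2 by norm_num)).comp_tendsto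
    (show Tendsto (fun z : ℂ => z - w) (𝓝 w) (𝓝 0) by
      simpa using (continuous_sub_right w).tendsto w))

/-- The Herglotz kernel `t ↦ (1 + t z) / (t - z)`. -/
noncomputable def herglotzKernel (z : ℂ) : ℝ →ᵇ ℂ :=
  z • 1 + (1 + z ^ 2) • resolventBCF z

theorem herglotzKernel_apply {z : ℂ} (hz : z.im ≠ 0) (t : ℝ) :
    herglotzKernel z t = (1 + t * z) / (t - z) := by
  have h1 := ofReal_sub_ne_zero hz t
  have h2 : (1 : ℝ →ᵇ ℂ) t = 1 := rfl
  simp only [herglotzKernel, BoundedContinuousFunction.add_apply,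
    BoundedContinuousFunction.smul_apply, h2,
    resolventBCF_apply hz, smul_eq_mul]
  field_simp
  ring

theorem herglotzKernel_conj {z : ℂ} (hz : z.im ≠ 0) :
    herglotzKernel (conj z) = star (herglotzKernel z) := by
  ext t
  have hz' : (conj z).im ≠ 0 := by simpa using hz
  rw [BoundedContinuousFunction.star_apply, herglotzKernel_apply hz, herglotzKernel_apply hz']
  simp

theorem herglotzKernel_im_nonneg {z : ℂ} (hz : z.im ≠ 0) (t : ℝ) :
    0 ≤ ((((z.im)⁻¹ : ℝ) : ℂ) • herglotzKernel z t).im := by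
  have h1 := ofReal_sub_ne_zero hz t
  rw [smul_eq_mul, im_ofReal_mul, herglotzKernel_apply hz, div_eq_mul_inv, inv_def]
  have : (z.im)⁻¹ * ((1 + (t : ℂ) * z) * (conj ((t : ℂ) - z) * (((normSq ((t : ℂ) - z))⁻¹ : ℝ) : ℂ))).im
      = (1 + t ^ 2) * (normSq ((t : ℂ) - z))⁻¹ := by
    rw [← mul_assoc, im_mul_ofReal]
    simp [field]
    ring
  rw [this]
  have := normSq_nonneg ((t : ℂ) - z)
  positivity

/-! ### Positive functionals and weak-* compactness -/

/-- A functional on bounded continuous functions is positive if it respects complex conjugation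
and the functions with nonnegative imaginary part. -/
structure IsPositiveFunctional (Λ : (ℝ →ᵇ ℂ) → ℂ) : Prop where
  map_star : ∀ φ, Λ (star φ) = conj (Λ φ)
  im_nonneg : ∀ φ : ℝ →ᵇ ℂ, (∀ t, 0 ≤ (φ t).im) → 0 ≤ (Λ φ).im

/-- The kernel divided by Im z has imaginary part (1+t²)/|t-z|² ≥ 0 in both half-planes. -/
theorem IsPositiveFunctional.isHerglotz {Λ : (ℝ →ᵇ ℂ) →L[ℂ] ℂ} (hΛ : IsPositiveFunctional Λ) :
    IsHerglotz fun z => Λ (herglotzKernel z) where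
  holomorphic := by
    intro z hz
    have hR := (hasDerivAt_resolventBCF hz).differentiableAt
    have hk : DifferentiableAt ℂ herglotzKernel z := by
      unfold herglotzKernel
      refine DifferentiableAt.add (by fun_prop) (DifferentiableAt.fun_smul (by fun_prop) hR)
    exact (Λ.differentiableAt.comp z hk).differentiableWithinAt
  im_div_im_nonneg := by
    intro z hz
    have := hΛ.im_nonneg ((((z.im)⁻¹ : ℝ) : ℂ) • herglotzKernel z) fun t => by
      rw [BoundedContinuousFunction.smul_apply]
      exact herglotzKernel_im_nonneg hz t
    rw [map_smul, smul_eq_mul, im_ofReal_mul] at this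
    rwa [div_eq_inv_mul]
  conj_symm := by
    intro z hz
    rw [herglotzKernel_conj hz, hΛ.map_star]

theorem integrable_mul_weight {w : ℝ → ℝ} (hw : Integrable w) (φ : ℝ →ᵇ ℂ) :
    Integrable fun t => φ t * w t :=
  hw.ofReal.bdd_mul φ.continuous.aestronglyMeasurable (ae_of_all _ φ.norm_coe_le_norm)

theorem norm_integral_mul_weight_le {w : ℝ → ℝ} (hw : Integrable w) (h0 : ∀ t, 0 ≤ w t)
    (φ : ℝ →ᵇ ℂ) : ‖∫ t, φ t * w t‖ ≤ (∫ t, w t) * ‖φ‖ := by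
  rw [← integral_mul_const]
  refine norm_integral_le_of_norm_le (hw.mul_const _) (ae_of_all _ fun t => ?_)
  rw [norm_mul, mul_comm, norm_real, Real.norm_of_nonneg (h0 t)]
  exact mul_le_mul_of_nonneg_left (φ.norm_coe_le_norm t) (h0 t)

theorem exists_weightFunctional {w : ℝ → ℝ} (hw : Integrable w) (h0 : ∀ t, 0 ≤ w t) :
    ∃ Λ : (ℝ →ᵇ ℂ) →L[ℂ] ℂ, (∀ φ, Λ φ = ∫ t, φ t * w t) ∧ ‖Λ‖ ≤ ∫ t, w t := by
  refine ⟨LinearMap.mkContinuous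
    { toFun := fun φ => ∫ t, φ t * w t
      map_add' := fun φ ψ => ?_
      map_smul' := fun c φ => ?_ } (∫ t, w t) (norm_integral_mul_weight_le hw h0),
    fun φ => rfl, LinearMap.mkContinuous_norm_le _ (integral_nonneg h0) _⟩
  · rw [← integral_add (integrable_mul_weight hw φ) (integrable_mul_weight hw ψ)]
    exact integral_congr_ae (ae_of_all _ fun t => by simp [add_mul])
  · rw [RingHom.id_apply, smul_eq_mul, ← integral_const_mul]
    exact integral_congr_ae (ae_of_all _ fun t => by simp [mul_assoc])

theorem isPositiveFunctional_weight {w : ℝ → ℝ} (hw : Integrable w) (h0 : ∀ t, 0 ≤ w t) :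
    IsPositiveFunctional fun φ => ∫ t, φ t * w t where
  map_star φ := by
    rw [← integral_conj]
    exact integral_congr_ae (ae_of_all _ fun t => by simp)
  im_nonneg φ hφ := by
    have := integral_im (integrable_mul_weight hw φ)
    change ∫ t, (φ t * w t).im = (∫ t, φ t * w t).im at this
    show 0 ≤ (∫ t, φ t * w t).im
    rw [← this]
    refine integral_nonneg fun t => ?_
    show 0 ≤ (φ t * w t).im
    rw [im_mul_ofReal]
    exact mul_nonneg (hφ t) (h0 t)

theorem IsPositiveFunctional.of_tendsto {ι : Type*} {l : Filter ι} [l.NeBot]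
    {L : ι → (ℝ →ᵇ ℂ) → ℂ} {Λ : (ℝ →ᵇ ℂ) → ℂ} (hL : ∀ᶠ i in l, IsPositiveFunctional (L i))
    (h : ∀ φ, Tendsto (fun i => L i φ) l (𝓝 (Λ φ))) : IsPositiveFunctional Λ where
  map_star φ := by
    refine tendsto_nhds_unique ((h (star φ)).congr' ?_)
      ((continuous_conj.tendsto _).comp (h φ))
    filter_upwards [hL] with i hi
    exact hi.map_star φ
  im_nonneg φ hφ := by
    refine ge_of_tendsto ((continuous_im.tendsto _).comp (h φ)) ?_
    filter_upwards [hL] with i hi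
    exact hi.im_nonneg φ hφ

/-- Banach–Alaoglu. An ultrafilter replaces subsequences, so no metrizability of the dual ball is
needed. -/
theorem exists_tendsto_weight {ι : Type*} (U : Ultrafilter ι) {w : ι → ℝ → ℝ} {C : ℝ}
    (hw : ∀ᶠ i in U, Integrable (w i)) (h0 : ∀ i t, 0 ≤ w i t)
    (hC : ∀ᶠ i in U, ∫ t, w i t ≤ C) :
    ∃ Λ : (ℝ →ᵇ ℂ) →L[ℂ] ℂ, IsPositiveFunctional Λ ∧
      ∀ φ : ℝ →ᵇ ℂ, Tendsto (fun i => ∫ t, φ t * w i t) U (𝓝 (Λ φ)) := by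
  have hex : ∀ i, ∃ Λ : (ℝ →ᵇ ℂ) →L[ℂ] ℂ, Integrable (w i) →
      (∀ φ, Λ φ = ∫ t, φ t * w i t) ∧ ‖Λ‖ ≤ ∫ t, w i t := fun i => by
    by_cases h : Integrable (w i)
    · obtain ⟨Λ, hΛ⟩ := exists_weightFunctional h (h0 i)
      exact ⟨Λ, fun _ => hΛ⟩
    · exact ⟨0, fun h' => (h h').elim⟩
  choose L hL using hex
  have hcomp := WeakDual.isCompact_closedBall (𝕜 := ℂ) (E := ℝ →ᵇ ℂ) 0 C
  obtain ⟨Λ, -, hΛ⟩ := hcomp.ultrafilter_le_nhds (U.map fun i => StrongDual.toWeakDual (L i)) (by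
    rw [Ultrafilter.coe_map, le_principal_iff, mem_map]
    filter_upwards [hw, hC] with i h1 h2
    have := (hL i h1).2.trans h2
    simpa using this)
  have hlim : ∀ φ : ℝ →ᵇ ℂ, Tendsto (fun i => ∫ t, φ t * w i t) U
      (𝓝 (WeakDual.toStrongDual Λ φ)) := fun φ => by
    have h1 : Tendsto (fun i => StrongDual.toWeakDual (L i)) U (𝓝 Λ) := hΛ
    have h2 := ((WeakDual.eval_continuous φ).tendsto Λ).comp h1
    refine Tendsto.congr' ?_ h2
    filter_upwards [hw] with i hi
    exact (hL i hi).1 φ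
  refine ⟨WeakDual.toStrongDual Λ, ?_, hlim⟩
  refine IsPositiveFunctional.of_tendsto (l := (U : Filter ι))
    (L := fun i φ => ∫ t, φ t * w i t) ?_ hlim
  filter_upwards [hw] with i hi
  exact isPositiveFunctional_weight hi (h0 i)

/-! ### Growth of Herglotz functions -/

theorem IsHerglotz.im_nonneg {h : ℂ → ℂ} (hh : IsHerglotz h) {z : ℂ} (hz : 0 < z.im) :
    0 ≤ (h z).im := by
  have := hh.im_div_im_nonneg z hz.ne'
  rwa [le_div_iff₀ hz, zero_mul] at this

theorem isOpen_upperHalf (δ : ℝ) : IsOpen {t : ℂ | -δ < t.im} :=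
  isOpen_lt continuous_const continuous_im

/-- Growth of a holomorphic self-map of the upper half-plane. -/
theorem norm_le_of_im_nonneg {h : ℂ → ℂ} (hd : DifferentiableOn ℂ h {t | 0 < t.im})
    (hpos : ∀ t : ℂ, 0 < t.im → 0 ≤ (h t).im) {z : ℂ} (hz : 0 < z.im) :
    ‖h z‖ ≤ (2 + 2 * ‖h I‖) * (‖z + I‖ ^ 2 / (2 * z.im)) := by
  set c : ℂ → ℂ := fun w => I * (1 + w) / (1 - w) with hc
  have hne : ∀ w ∈ Metric.ball (0 : ℂ) 1, 1 - w ≠ 0 := fun w hw h => by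
    rw [mem_ball_zero_iff, ← sub_eq_zero.1 h] at hw
    simp at hw
  have hcim : ∀ w ∈ Metric.ball (0 : ℂ) 1, 0 < (c w).im := fun w hw => by
    have h1 : 0 < normSq (1 - w) := normSq_pos.2 (hne w hw)
    have e : (c w).im = (1 - normSq w) / normSq (1 - w) := by
      simp only [hc]
      rw [div_im, normSq_apply w]
      simp only [mul_im, mul_re, I_re, I_im, add_re, add_im, one_re, one_im, sub_re, sub_im]
      field_simp
      ring
    have h2 : normSq w < 1 := by
      rw [← Complex.sq_norm]
      have := mem_ball_zero_iff.1 hw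
      nlinarith [norm_nonneg w]
    rw [e]
    exact div_pos (by linarith) h1
  have hcd : DifferentiableOn ℂ c (Metric.ball 0 1) :=
    DifferentiableOn.div (by fun_prop) (by fun_prop) hne
  have hf : DifferentiableOn ℂ (fun w => I * h (c w)) (Metric.ball 0 1) :=
    (hd.comp hcd hcim).const_mul I
  have hzI : z + I ≠ 0 := fun h => by
    have := congrArg im h
    simp at this
    linarith
  set w := (z - I) / (z + I) with hw
  have hsq : ‖z - I‖ ^ 2 = ‖z + I‖ ^ 2 - 4 * z.im := by
    rw [Complex.sq_norm, Complex.sq_norm, normSq_apply, normSq_apply]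
    simp
    ring
  have hN : 0 < ‖z + I‖ := norm_pos_iff.2 hzI
  have hwn : ‖w‖ = ‖z - I‖ / ‖z + I‖ := norm_div _ _
  have hw1 : ‖w‖ < 1 := by
    rw [hwn, div_lt_one hN]
    nlinarith [norm_nonneg (z - I)]
  have hcw : c w = z := by
    have h1 : 1 - w = 2 * I / (z + I) := by rw [hw]; field_simp; ring
    have h2 : 1 + w = 2 * z / (z + I) := by rw [hw]; field_simp; ring
    simp only [hc]
    rw [h1, h2]
    field_simp
  have hc0 : c 0 = I := by simp [hc]
  -- Here Re(i h) = -Im h ≤ 0; the bound 1 is used because the inequality is applied with a positive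
  -- bound.
  have key := borelCaratheodory (M := 1) one_pos hf (fun t ht => by
    have := hpos _ (hcim t ht)
    show (I * h (c t)).re ≤ 1
    simp
    linarith) one_pos (mem_ball_zero_iff.2 hw1)
  simp only [hcw, hc0, norm_mul, norm_I, one_mul] at key
  have hw2 : ‖w‖ ^ 2 = 1 - 4 * z.im / ‖z + I‖ ^ 2 := by
    rw [hwn, div_pow, hsq]
    field_simp
  have h1w : 0 < 1 - ‖w‖ := by linarith
  -- From 1 - |w|² = 4 Im z/|z+i|² and 1 + |w| ≤ 2.
  have hinv : 1 / (1 - ‖w‖) ≤ ‖z + I‖ ^ 2 / (2 * z.im) := by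
    rw [div_le_div_iff₀ h1w (by positivity), one_mul]
    have e : 4 * z.im = (1 - ‖w‖) * (1 + ‖w‖) * ‖z + I‖ ^ 2 := by
      have : (1 - ‖w‖) * (1 + ‖w‖) = 4 * z.im / ‖z + I‖ ^ 2 := by linear_combination -hw2
      rw [this]; field_simp
    nlinarith [mul_pos h1w (pow_pos hN 2)]
  calc ‖h z‖ ≤ _ := key
    _ ≤ 2 * 1 * 1 / (1 - ‖w‖) + ‖h I‖ * (1 + 1) / (1 - ‖w‖) := by gcongr
    _ = (2 + 2 * ‖h I‖) * (1 / (1 - ‖w‖)) := by ring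
    _ ≤ _ := by gcongr

theorem IsHerglotz.exists_growth {h : ℂ → ℂ} (hh : IsHerglotz h) :
    ∃ M : ℝ, 0 ≤ M ∧ ∀ z ∈ nonRealPlane, ‖h z‖ ≤ M * ((1 + ‖z‖ ^ 2) / |z.im|) := by
  have hup : ∀ z : ℂ, 0 < z.im → ‖h z‖ ≤ (2 + 2 * ‖h I‖) * ((1 + ‖z‖ ^ 2) / |z.im|) := by
    intro z hz
    refine (norm_le_of_im_nonneg (hh.holomorphic.mono fun t ht => ne_of_gt ht)
      (fun t ht => hh.im_nonneg ht) hz).trans ?_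
    have h1 : ‖z + I‖ ≤ ‖z‖ + 1 := (norm_add_le _ _).trans (by simp)
    have h2 : ‖z + I‖ ^ 2 ≤ 2 * (1 + ‖z‖ ^ 2) := by
      nlinarith [norm_nonneg (z + I), sq_nonneg (‖z‖ - 1)]
    rw [abs_of_pos hz]
    gcongr ?_ * ?_
    rw [div_le_div_iff₀ (by positivity) hz]
    nlinarith
  refine ⟨2 + 2 * ‖h I‖, by positivity, fun z hz => ?_⟩
  rcases lt_or_gt_of_ne (show z.im ≠ 0 from hz) with h1 | h1
  · have := hup (conj z) (by simpa using h1)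
    rw [← hh.conj_symm z hz] at this
    simpa using this
  · exact hup z h1

/-! ### Regularity of Herglotz functions -/

/-- For w ≠ 0 the quotient is 1/(1/w - iε), and 1/w - iε has imaginary part at most -ε. This
regularization makes a function with nonnegative imaginary part bounded and keeps the sign. -/
theorem one_sub_mul_I_bounds {w : ℂ} (hw : 0 ≤ w.im) {ε : ℝ} (hε : 0 < ε) :
    1 - ε * I * w ≠ 0 ∧ ‖w / (1 - ε * I * w)‖ ≤ ε⁻¹ ∧ 0 ≤ (w / (1 - ε * I * w)).im := by
  have hre : (1 - ε * I * w).re = 1 + ε * w.im := by simp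
  have him : (1 - ε * I * w).im = - (ε * w.re) := by simp
  have hεw := mul_nonneg hε.le hw
  have hne : 1 - ε * I * w ≠ 0 := fun h => by
    rw [h, zero_re] at hre
    linarith
  have hpos : 0 < ‖1 - ε * I * w‖ := norm_pos_iff.2 hne
  refine ⟨hne, ?_, ?_⟩
  · rw [norm_div, div_le_iff₀ hpos]
    have : (ε * ‖w‖) ^ 2 ≤ ‖1 - ε * I * w‖ ^ 2 := by
      rw [mul_pow, Complex.sq_norm, Complex.sq_norm, normSq_apply, normSq_apply, hre, him]
      nlinarith
    have := (sq_le_sq₀ (by positivity) hpos.le).1 this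
    rw [← div_eq_inv_mul, le_div_iff₀ hε]
    linarith
  · rw [div_im, hre, him, ← sub_div]
    refine div_nonneg ?_ (normSq_nonneg _)
    nlinarith [mul_self_nonneg w.re, mul_self_nonneg w.im]

/-- Cauchy's formula at i for g(t)/(t+i), which gains the decay that a merely bounded g lacks. -/
theorem tendsto_integral_div_one_add_sq {g : ℂ → ℂ} {δ C : ℝ} (hδ : 0 < δ)
    (hg : DifferentiableOn ℂ g {t | -δ < t.im}) (hC : 0 ≤ C)
    (hb : ∀ t : ℂ, 0 ≤ t.im → ‖g t‖ ≤ C) :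
    Tendsto (fun s : ℝ => ∫ t in (-s ^ 3)..(s ^ 3), g t / (1 + (t : ℂ) ^ 2)) atTop
      (𝓝 (Real.pi * g I)) := by
  have hmin : 0 < min δ 1 := lt_min hδ one_pos
  have hne : ∀ t : ℂ, -min δ 1 < t.im → t + I ≠ 0 := fun t ht h => by
    have := congrArg im h
    simp at this
    linarith [min_le_right δ 1]
  have key := tendsto_cauchy_integral_upper_of_im_pos (g := fun t => g t / (t + I))
    (δ := min δ 1) (ρ := 1) (C := 4 * C) (R₀ := 2) (z := I) hmin one_pos (by positivity) (by
      refine DifferentiableOn.div (hg.mono fun t ht => ?_) (by fun_prop) fun t ht => hne t ht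
      have h1 : -min δ 1 < t.im := ht
      exact lt_of_le_of_lt (neg_le_neg (min_le_left δ 1)) h1)
    (by
      intro t ht hR
      have him : t.im ≤ ‖t‖ := (le_abs_self _).trans (abs_im_le_norm t)
      have h2 : ‖t‖ / 2 ≤ ‖t + I‖ := by
        simpa using half_norm_le_norm_sub (t := t) (z := -I) (by simpa using hR)
      rw [norm_div]
      calc ‖g t‖ / ‖t + I‖ ≤ C / (‖t‖ / 2) := by
            gcongr
            exact hb t ht
        _ ≤ C / ((1 + t.im) / 4) := div_le_div_of_nonneg_left hC (by linarith) (by linarith)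
        _ = 4 * C / (1 + t.im) := by field_simp) (by simp)
  convert key using 2
  · refine intervalIntegral.integral_congr fun t _ => ?_
    have h1 : (t : ℂ) + I ≠ 0 := hne t (by rw [ofReal_im]; linarith)
    have h2 : (t : ℂ) - I ≠ 0 := ofReal_sub_ne_zero (by simp) t
    have h3 : 1 + (t : ℂ) ^ 2 = ((t : ℂ) + I) * (t - I) := by
      linear_combination I_sq
    rw [h3, div_div]
  · field_simp
    ring

theorem lintegral_im_le_of_bounded {g : ℂ → ℂ} {δ C : ℝ} (hδ : 0 < δ)
    (hg : DifferentiableOn ℂ g {t | -δ < t.im}) (hC : 0 ≤ C)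
    (hb : ∀ t : ℂ, 0 ≤ t.im → ‖g t‖ ≤ C) (hpos : ∀ t : ℝ, 0 ≤ (g t).im) :
    ∫⁻ t : ℝ, ENNReal.ofReal ((g t).im / (1 + t ^ 2)) ≤ ENNReal.ofReal (Real.pi * (g I).im) := by
  have hcont : Continuous fun t : ℝ => g t / (1 + (t : ℂ) ^ 2) := by
    refine Continuous.div (hg.continuousOn.comp_continuous continuous_ofReal fun t => ?_)
      (by fun_prop) fun t => ?_
    · show -δ < (t : ℂ).im
      rw [ofReal_im]; linarith
    · exact_mod_cast (show (1 + t ^ 2 : ℝ) ≠ 0 by positivity)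
  have him : ∀ t : ℝ, (g t / (1 + (t : ℂ) ^ 2)).im = (g t).im / (1 + t ^ 2) := fun t => by
    rw [← div_ofReal_im]
    push_cast
    rfl
  have hcont' : Continuous fun t : ℝ => (g t).im / (1 + t ^ 2) := by
    simp_rw [← him]
    exact continuous_im.comp hcont
  have hnn : ∀ t : ℝ, 0 ≤ (g t).im / (1 + t ^ 2) := fun t => div_nonneg (hpos t) (by positivity)
  have h1 : Tendsto (fun s : ℝ => ∫ t in (-s ^ 3)..(s ^ 3), (g t).im / (1 + t ^ 2)) atTop
      (𝓝 (Real.pi * (g I).im)) := by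
    have := (continuous_im.tendsto _).comp (tendsto_integral_div_one_add_sq hδ hg hC hb)
    rw [im_ofReal_mul] at this
    refine this.congr fun s => ?_
    simp_rw [← him]
    exact (imCLM.intervalIntegral_comp_comm (hcont.intervalIntegrable _ _)).symm
  have hcube : Tendsto (fun s : ℝ => s ^ 3) atTop atTop := tendsto_pow_atTop (by norm_num)
  have hcov : AECover volume atTop fun s : ℝ => Set.Ioc (-s ^ 3) (s ^ 3) :=
    aecover_Ioc (tendsto_neg_atTop_atBot.comp hcube) hcube
  have h2 := hcov.lintegral_tendsto_of_countably_generated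
    (f := fun t => ENNReal.ofReal ((g t).im / (1 + t ^ 2)))
    hcont'.measurable.ennreal_ofReal.aemeasurable
  refine (tendsto_nhds_unique h2 ((ENNReal.tendsto_ofReal h1).congr' ?_)).le
  filter_upwards [eventually_ge_atTop 0] with s hs
  rw [intervalIntegral.integral_of_le (by linarith [pow_nonneg hs 3]),
    ofReal_integral_eq_lintegral_ofReal (hcont'.integrableOn_Ioc) (ae_of_all _ hnn)]

/-- Regularize by h/(1 - iεh), apply the bounded case and let ε → 0 with Fatou. Only an inequality
survives, since a linear term of h puts mass at infinity. -/
theorem lintegral_im_le {h : ℂ → ℂ} {δ : ℝ} (hδ : 0 < δ)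
    (hd : DifferentiableOn ℂ h {t | -δ < t.im}) (hpos : ∀ t : ℂ, -δ < t.im → 0 ≤ (h t).im) :
    ∫⁻ t : ℝ, ENNReal.ofReal ((h t).im / (1 + t ^ 2)) ≤ ENNReal.ofReal (Real.pi * (h I).im) := by
  set ε : ℕ → ℝ := fun n => 1 / ((n : ℝ) + 1) with hε
  have hε0 : ∀ n, 0 < ε n := fun n => Nat.one_div_pos_of_nat
  have hεt : Tendsto ε atTop (𝓝 0) := tendsto_one_div_add_atTop_nhds_zero_nat
  have hlim : ∀ t : ℂ, Tendsto (fun n => (h t / (1 - ε n * I * h t)).im) atTop (𝓝 (h t).im) := by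
    intro t
    have h1 : Tendsto (fun n => 1 - (ε n : ℂ) * I * h t) atTop (𝓝 (1 - ((0 : ℝ) : ℂ) * I * h t)) :=
      (((continuous_ofReal.tendsto _).comp hεt).mul_const _ |>.mul_const _).const_sub _
    have h2 := (tendsto_const_nhds (x := h t)).div h1 (by simp)
    simpa [Function.comp_def] using (continuous_im.tendsto _).comp h2
  have hbd : ∀ n, ∫⁻ t : ℝ, ENNReal.ofReal ((h t / (1 - ε n * I * h t)).im / (1 + t ^ 2)) ≤
      ENNReal.ofReal (Real.pi * (h I / (1 - ε n * I * h I)).im) := fun n => by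
    refine lintegral_im_le_of_bounded (g := fun t => h t / (1 - ε n * I * h t)) (C := (ε n)⁻¹) hδ
      (hd.div (by fun_prop) fun t ht => (one_sub_mul_I_bounds (hpos t ht) (hε0 n)).1)
      (inv_nonneg.2 (hε0 n).le)
      (fun t ht => (one_sub_mul_I_bounds (hpos t (by linarith)) (hε0 n)).2.1)
      (fun t => (one_sub_mul_I_bounds (hpos t (by rw [ofReal_im]; linarith)) (hε0 n)).2.2)
  have hcont : Continuous fun t : ℝ => h t :=
    hd.continuousOn.comp_continuous continuous_ofReal fun t => by
      show -δ < (t : ℂ).im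
      rw [ofReal_im]; linarith
  have hmeas : ∀ n, Measurable fun t : ℝ =>
      ENNReal.ofReal ((h t / (1 - ε n * I * h t)).im / (1 + t ^ 2)) := fun n => by
    have h1 : Measurable fun t : ℝ => h t / (1 - ε n * I * h t) :=
      hcont.measurable.div ((hcont.measurable.const_mul _).const_sub _)
    exact ((measurable_im.comp h1).div (by fun_prop)).ennreal_ofReal
  have hpt : ∀ t : ℝ, ENNReal.ofReal ((h t).im / (1 + t ^ 2)) =
      liminf (fun n => ENNReal.ofReal ((h t / (1 - ε n * I * h t)).im / (1 + t ^ 2))) atTop :=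
    fun t => (ENNReal.tendsto_ofReal ((hlim t).div_const _)).liminf_eq.symm
  calc ∫⁻ t : ℝ, ENNReal.ofReal ((h t).im / (1 + t ^ 2))
      = ∫⁻ t : ℝ, liminf (fun n => ENNReal.ofReal
          ((h t / (1 - ε n * I * h t)).im / (1 + t ^ 2))) atTop := lintegral_congr hpt
    _ ≤ liminf (fun n => ∫⁻ t : ℝ, ENNReal.ofReal
          ((h t / (1 - ε n * I * h t)).im / (1 + t ^ 2))) atTop := lintegral_liminf_le hmeas
    _ ≤ liminf (fun n => ENNReal.ofReal (Real.pi * (h I / (1 - ε n * I * h I)).im)) atTop :=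
        liminf_le_liminf (Eventually.of_forall hbd)
    _ = _ := (ENNReal.tendsto_ofReal ((hlim I).const_mul _)).liminf_eq

/-- The regularity integral of a function at height `r`. -/
noncomputable def jumpIntegral (q : ℂ → ℂ) (r : ℝ) : ℝ≥0∞ :=
  ∫⁻ t : ℝ, ENNReal.ofReal
    (‖q ((t : ℂ) + I * (r : ℂ)) - q ((t : ℂ) - I * (r : ℂ))‖ / (1 + t ^ 2))

theorem continuous_line {q : ℂ → ℂ} (hq : DifferentiableOn ℂ q nonRealPlane) {r : ℝ} (hr : r ≠ 0) :
    Continuous fun t : ℝ => q ((t : ℂ) + I * r) :=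
  hq.continuousOn.comp_continuous (by fun_prop) fun t => by
    show ((t : ℂ) + I * r).im ≠ 0
    simpa using hr

theorem continuous_jump {q : ℂ → ℂ} (hq : DifferentiableOn ℂ q nonRealPlane) {r : ℝ} (hr : r ≠ 0) :
    Continuous fun t : ℝ => q ((t : ℂ) + I * r) - q ((t : ℂ) - I * r) := by
  refine (continuous_line hq hr).sub ?_
  have := continuous_line hq (neg_ne_zero.2 hr)
  simpa [sub_eq_add_neg] using this

theorem IsHerglotz.exists_jumpIntegral_le {h : ℂ → ℂ} (hh : IsHerglotz h) :
    ∃ C : ℝ, ∀ r ∈ Set.Ioo (0 : ℝ) 1, jumpIntegral h r ≤ ENNReal.ofReal C := by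
  obtain ⟨M, hM, hb⟩ := hh.exists_growth
  refine ⟨Real.pi * (2 * (5 * M)), fun r hr => ?_⟩
  have hp : ∀ t : ℂ, -r < t.im → 0 < (t + I * r).im := fun t ht => by
    simp
    linarith
  have hjump : ∀ t : ℝ, ‖h ((t : ℂ) + I * r) - h ((t : ℂ) - I * r)‖ = (2 * h (t + I * r)).im := by
    intro t
    have h1 := hp t (by rw [ofReal_im]; linarith [hr.1])
    have h2 : (t : ℂ) - I * r = conj ((t : ℂ) + I * r) := by simp; ring
    have h3 := hh.im_nonneg h1
    rw [h2, ← hh.conj_symm _ h1.ne']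
    have e : h ((t : ℂ) + I * r) - conj (h ((t : ℂ) + I * r)) =
        ((2 * (h ((t : ℂ) + I * r)).im : ℝ) : ℂ) * I := by
      apply Complex.ext <;> simp
      ring
    rw [e, norm_mul, norm_I, mul_one, norm_real, Real.norm_of_nonneg (by positivity)]
    simp
  have key := lintegral_im_le (h := fun t => 2 * h (t + I * r)) hr.1
    (DifferentiableOn.const_mul (hh.holomorphic.comp (by fun_prop) fun t ht => (hp t ht).ne') _)
    (fun t ht => by
      have := hh.im_nonneg (hp t ht)
      simpa using this)
  unfold jumpIntegral
  simp_rw [hjump]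
  refine key.trans (ENNReal.ofReal_le_ofReal ?_)
  have hI := hp I (by simp; linarith [hr.1])
  have h1 : (2 * h (I + I * r)).im ≤ 2 * ‖h (I + I * r)‖ := by
    have := (le_abs_self _).trans (abs_im_le_norm (h (I + I * r)))
    simpa using this
  have h2 := hb (I + I * r) hI.ne'
  have h3 : (I + I * (r : ℂ)) = ((1 + r : ℝ) : ℂ) * I := by push_cast; ring
  have h4 : ‖I + I * (r : ℂ)‖ = 1 + r := by
    rw [h3, norm_mul, norm_I, mul_one, norm_real, Real.norm_of_nonneg (by linarith [hr.1])]
  have h5 : |(I + I * (r : ℂ)).im| = 1 + r := by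
    rw [h3]
    simp [abs_of_pos (show 0 < 1 + r by linarith [hr.1])]
  rw [h4, h5] at h2
  -- A crude bound; only uniformity in r ∈ (0,1) matters.
  have h6 : (1 + (1 + r) ^ 2) / (1 + r) ≤ 5 := by
    rw [div_le_iff₀ (by linarith [hr.1])]
    nlinarith [hr.1, hr.2]
  have h7 := mul_le_mul_of_nonneg_left h6 hM
  gcongr
  linarith

/-! ### Necessity of the two conditions -/

theorem IsQuasiHerglotz.exists_growth {q : ℂ → ℂ} (hq : IsQuasiHerglotz q) :
    ∃ M : ℝ, 0 ≤ M ∧ ∀ z ∈ nonRealPlane, ‖q z‖ ≤ M * ((1 + ‖z‖ ^ 2) / |z.im|) := by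
  obtain ⟨h₁, h₂, h₃, h₄, H₁, H₂, H₃, H₄, e⟩ := hq
  obtain ⟨M₁, p₁, b₁⟩ := H₁.exists_growth
  obtain ⟨M₂, p₂, b₂⟩ := H₂.exists_growth
  obtain ⟨M₃, p₃, b₃⟩ := H₃.exists_growth
  obtain ⟨M₄, p₄, b₄⟩ := H₄.exists_growth
  refine ⟨(M₁ + M₂) + (M₃ + M₄), by positivity, fun z hz => ?_⟩
  rw [e z hz, add_mul, add_mul, add_mul]
  refine (norm_add_le _ _).trans (add_le_add ((norm_sub_le _ _).trans
    (add_le_add (b₁ z hz) (b₂ z hz))) ?_)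
  rw [norm_mul, norm_I, one_mul]
  exact (norm_sub_le _ _).trans (add_le_add (b₃ z hz) (b₄ z hz))

theorem IsQuasiHerglotz.iSup_jumpIntegral_lt_top {q : ℂ → ℂ} (hq : IsQuasiHerglotz q) :
    (⨆ r ∈ Set.Ioo (0 : ℝ) 1, jumpIntegral q r) < ∞ := by
  obtain ⟨h₁, h₂, h₃, h₄, H₁, H₂, H₃, H₄, e⟩ := hq
  obtain ⟨C₁, b₁⟩ := H₁.exists_jumpIntegral_le
  obtain ⟨C₂, b₂⟩ := H₂.exists_jumpIntegral_le
  obtain ⟨C₃, b₃⟩ := H₃.exists_jumpIntegral_le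
  obtain ⟨C₄, b₄⟩ := H₄.exists_jumpIntegral_le
  refine lt_of_le_of_lt (b := ENNReal.ofReal C₁ + (ENNReal.ofReal C₂ +
    (ENNReal.ofReal C₃ + ENNReal.ofReal C₄))) (iSup₂_le fun r hr => ?_) (by simp)
  refine le_trans ?_ (add_le_add (b₁ r hr) (add_le_add (b₂ r hr) (add_le_add (b₃ r hr) (b₄ r hr))))
  have hmeas : ∀ {h : ℂ → ℂ}, IsHerglotz h → Measurable fun t : ℝ => ENNReal.ofReal
      (‖h ((t : ℂ) + I * (r : ℂ)) - h ((t : ℂ) - I * (r : ℂ))‖ / (1 + t ^ 2)) := fun hh => by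
    have := (continuous_jump hh.holomorphic hr.1.ne').norm.measurable
    fun_prop
  unfold jumpIntegral
  rw [← lintegral_add_left (hmeas H₃), ← lintegral_add_left (hmeas H₂),
    ← lintegral_add_left (hmeas H₁)]
  refine lintegral_mono fun t => ?_
  have hp : (t : ℂ) + I * r ∈ nonRealPlane := by
    show ((t : ℂ) + I * r).im ≠ 0
    simpa using hr.1.ne'
  have hm : (t : ℂ) - I * r ∈ nonRealPlane := by
    show ((t : ℂ) - I * r).im ≠ 0
    simpa using hr.1.ne'
  simp only
  rw [← ENNReal.ofReal_add (by positivity) (by positivity),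
    ← ENNReal.ofReal_add (by positivity) (by positivity),
    ← ENNReal.ofReal_add (by positivity) (by positivity), ← add_div, ← add_div, ← add_div,
    e _ hp, e _ hm]
  refine ENNReal.ofReal_le_ofReal (div_le_div_of_nonneg_right ?_ (by positivity))
  set a₁ := h₁ ((t : ℂ) + I * r)
  set a₂ := h₂ ((t : ℂ) + I * r)
  set a₃ := h₃ ((t : ℂ) + I * r)
  set a₄ := h₄ ((t : ℂ) + I * r)
  set c₁ := h₁ ((t : ℂ) - I * r)
  set c₂ := h₂ ((t : ℂ) - I * r)
  set c₃ := h₃ ((t : ℂ) - I * r)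
  set c₄ := h₄ ((t : ℂ) - I * r)
  have e' : a₁ - a₂ + I * (a₃ - a₄) - (c₁ - c₂ + I * (c₃ - c₄)) =
      ((a₁ - c₁) - (a₂ - c₂)) + I * ((a₃ - c₃) - (a₄ - c₄)) := by ring
  rw [e']
  have n1 := norm_add_le ((a₁ - c₁) - (a₂ - c₂)) (I * ((a₃ - c₃) - (a₄ - c₄)))
  rw [norm_mul, norm_I, one_mul] at n1
  linarith [norm_sub_le (a₁ - c₁) (a₂ - c₂), norm_sub_le (a₃ - c₃) (a₄ - c₄)]

/-! ### Cauchy representation of the shifted function -/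

/-- The numerator p(t+ir) - (a+bt) vanishes at i, so `dslope` at i divided by t+i extends the
quotient across i. Division by 1+t² absorbs the quadratic growth and leaves the decay 1/(r + Im t)
that the Cauchy formulas require. -/
theorem exists_interpolation_quotient {p : ℂ → ℂ} (hp : DifferentiableOn ℂ p {t | 0 < t.im})
    {M : ℝ} (hM : 0 ≤ M) (hb : ∀ t : ℂ, 0 < t.im → ‖p t‖ ≤ M * ((1 + ‖t‖ ^ 2) / |t.im|))
    {r : ℝ} (hr : 0 < r) {a b : ℂ} (hab : a + b * I = p (I + I * r)) :
    ∃ (g : ℂ → ℂ) (C : ℝ), 0 ≤ C ∧ DifferentiableOn ℂ g {t | -min r 1 < t.im} ∧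
      (∀ t : ℂ, 0 ≤ t.im → 2 ≤ ‖t‖ → ‖g t‖ ≤ C / (r + t.im)) ∧
      ∀ t : ℂ, -min r 1 < t.im → t ≠ I → g t = (p (t + I * r) - (a + b * t)) / (1 + t ^ 2) := by
  set f : ℂ → ℂ := fun t => p (t + I * r) - (a + b * t) with hf
  have hfI : f I = 0 := by simp [hf, hab]
  have hmin : 0 < min r 1 := lt_min hr one_pos
  have hpos : ∀ t ∈ {t : ℂ | -min r 1 < t.im}, 0 < (t + I * r).im := fun t ht => by
    have h1 : -min r 1 < t.im := ht
    simp only [add_im, mul_im, I_re, I_im, ofReal_re, ofReal_im, zero_mul, one_mul, zero_add]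
    linarith [min_le_left r 1]
  have hne : ∀ t ∈ {t : ℂ | -min r 1 < t.im}, t + I ≠ 0 := fun t ht h => by
    have h1 : -min r 1 < t.im := ht
    have := congrArg im h
    simp at this
    linarith [min_le_right r 1]
  have hfd : DifferentiableOn ℂ f {t | -min r 1 < t.im} :=
    (hp.comp (by fun_prop) hpos).sub (by fun_prop)
  have hI : I ∈ {t : ℂ | -min r 1 < t.im} := by
    show -min r 1 < I.im
    rw [I_im]; linarith
  have heq : ∀ t : ℂ, -min r 1 < t.im → t ≠ I →
      dslope f I t / (t + I) = f t / (1 + t ^ 2) := fun t ht htI => by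
    have h1 : 1 + t ^ 2 = (t - I) * (t + I) := by linear_combination I_sq
    rw [dslope_of_ne _ htI, slope_def_field, hfI, sub_zero, div_div, h1]
  set K : ℝ := M * (1 + (1 + r) ^ 2) + (‖a‖ + ‖b‖) * (r + 1) with hK
  refine ⟨fun t => dslope f I t / (t + I), 4 * K, by positivity, ?_, ?_, heq⟩
  · exact ((differentiableOn_dslope ((isOpen_upperHalf _).mem_nhds hI)).2 hfd).div
      (by fun_prop) hne
  · intro t ht hR
    have h1 : ‖t‖ / 2 ≤ ‖t + I‖ := by
      simpa using half_norm_le_norm_sub (t := t) (z := -I) (by simpa using hR)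
    have h2 : ‖t‖ / 2 ≤ ‖t - I‖ := half_norm_le_norm_sub (by simpa using hR)
    have htI : t ≠ I := fun h => by rw [h, norm_I] at hR; norm_num at hR
    have hm : -min r 1 < t.im := by linarith
    simp only
    rw [heq t hm htI]
    have him : t.im ≤ ‖t‖ := (le_abs_self _).trans (abs_im_le_norm t)
    have hden : (‖t‖ / 2) * (‖t‖ / 2) ≤ ‖1 + t ^ 2‖ := by
      have h3 : 1 + t ^ 2 = (t - I) * (t + I) := by linear_combination I_sq
      rw [h3, norm_mul]
      gcongr
    have ht0 : 0 < ‖t‖ := by linarith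
    have hri : 0 < r + t.im := by linarith
    have hnum : ‖f t‖ ≤ K * ‖t‖ ^ 2 / (r + t.im) := by
      have e1 := hb _ (hpos t hm)
      have e2 : (t + I * r).im = r + t.im := by simp [add_comm]
      have e3 : ‖t + I * r‖ ≤ ‖t‖ + r := (norm_add_le _ _).trans (by simp [abs_of_pos hr])
      rw [e2, abs_of_pos hri] at e1
      have e4 : 1 + ‖t + I * r‖ ^ 2 ≤ (1 + (1 + r) ^ 2) * ‖t‖ ^ 2 := by
        have : ‖t + I * r‖ ≤ (1 + r) * ‖t‖ := by nlinarith
        have := pow_le_pow_left₀ (norm_nonneg _) this 2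
        nlinarith
      have e5 : ‖a + b * t‖ ≤ (‖a‖ + ‖b‖) * (r + 1) * ‖t‖ ^ 2 / (r + t.im) := by
        rw [le_div_iff₀ hri]
        have f1 : ‖a + b * t‖ ≤ (‖a‖ + ‖b‖) * ‖t‖ := by
          refine (norm_add_le _ _).trans ?_
          rw [norm_mul]
          nlinarith [norm_nonneg a]
        have f2 : r + t.im ≤ (r + 1) * ‖t‖ := by nlinarith
        calc _ ≤ ((‖a‖ + ‖b‖) * ‖t‖) * ((r + 1) * ‖t‖) := by gcongr
          _ = _ := by ring
      calc ‖f t‖ ≤ _ := norm_sub_le _ _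
        _ ≤ M * ((1 + (1 + r) ^ 2) * ‖t‖ ^ 2 / (r + t.im)) +
            (‖a‖ + ‖b‖) * (r + 1) * ‖t‖ ^ 2 / (r + t.im) := by
          refine add_le_add (e1.trans ?_) e5
          gcongr
        _ = _ := by rw [hK]; ring
    rw [norm_div]
    calc ‖f t‖ / ‖1 + t ^ 2‖ ≤ (K * ‖t‖ ^ 2 / (r + t.im)) / ((‖t‖ / 2) * (‖t‖ / 2)) := by
          gcongr
      _ = _ := by field_simp; ring

theorem one_add_sq_ne_zero {z : ℂ} (h1 : z ≠ I) (h2 : z ≠ -I) : 1 + z ^ 2 ≠ 0 := by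
  have h3 : 1 + z ^ 2 = (z - I) * (z - -I) := by linear_combination I_sq
  rw [h3]
  exact mul_ne_zero (sub_ne_zero.2 h1) (sub_ne_zero.2 h2)

theorem tendsto_interpolation_upper {p : ℂ → ℂ} (hp : DifferentiableOn ℂ p {t | 0 < t.im})
    {M : ℝ} (hM : 0 ≤ M) (hb : ∀ t : ℂ, 0 < t.im → ‖p t‖ ≤ M * ((1 + ‖t‖ ^ 2) / |t.im|))
    {r : ℝ} (hr : 0 < r) {a b : ℂ} (hab : a + b * I = p (I + I * r)) {z : ℂ} (hz : z.im ≠ 0)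
    (hzI : z ≠ I) :
    Tendsto (fun s : ℝ => ∫ t in (-s ^ 3)..(s ^ 3),
      (p ((t : ℂ) + I * r) - (a + b * t)) / (1 + (t : ℂ) ^ 2) / ((t : ℂ) - z)) atTop
      (𝓝 (if 0 < z.im then 2 * Real.pi * I * ((p (z + I * r) - (a + b * z)) / (1 + z ^ 2))
        else 0)) := by
  obtain ⟨g, C, hC, hd, hg, heq⟩ := exists_interpolation_quotient hp hM hb hr hab
  have hmin : 0 < min r 1 := lt_min hr one_pos
  have hcongr : ∀ s : ℝ, ∫ t in (-s ^ 3)..(s ^ 3), g t / ((t : ℂ) - z) =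
      ∫ t in (-s ^ 3)..(s ^ 3),
        (p ((t : ℂ) + I * r) - (a + b * t)) / (1 + (t : ℂ) ^ 2) / ((t : ℂ) - z) := fun s =>
    intervalIntegral.integral_congr fun t _ => by
      rw [heq t (by rw [ofReal_im]; linarith) fun h => by simpa using congrArg im h]
  split_ifs with h
  · rw [← heq z (by linarith) hzI]
    exact (tendsto_cauchy_integral_upper_of_im_pos hmin hr hC hd hg h).congr hcongr
  · have h' : z.im < 0 := lt_of_le_of_ne (not_lt.1 h) hz
    exact (tendsto_cauchy_integral_upper_of_im_neg hmin hr hC hd hg h').congr hcongr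

/-- Translation by `i r` away from the real line. -/
noncomputable def awayShift (r : ℝ) (z : ℂ) : ℂ := if 0 < z.im then z + I * r else z - I * r

/-- The density of the jump of `q` at height `r`. -/
noncomputable def jumpDensity (q : ℂ → ℂ) (r : ℝ) (t : ℝ) : ℂ :=
  (q ((t : ℂ) + I * r) - q ((t : ℂ) - I * r)) / (1 + (t : ℂ) ^ 2) / (2 * Real.pi * I)

theorem one_add_ofReal_sq_ne_zero (t : ℝ) : 1 + (t : ℂ) ^ 2 ≠ 0 := by
  exact_mod_cast (show (1 + t ^ 2 : ℝ) ≠ 0 by positivity)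

theorem norm_jumpDensity_le (q : ℂ → ℂ) (r t : ℝ) :
    ‖jumpDensity q r t‖ ≤ ‖q ((t : ℂ) + I * r) - q ((t : ℂ) - I * r)‖ / (1 + t ^ 2) := by
  have h1 : ‖(1 + (t : ℂ) ^ 2)‖ = 1 + t ^ 2 := by
    have : (1 + (t : ℂ) ^ 2) = ((1 + t ^ 2 : ℝ) : ℂ) := by push_cast; rfl
    rw [this, norm_real, Real.norm_of_nonneg (by positivity)]
  have h2 : ‖(2 * Real.pi * I : ℂ)‖ = 2 * Real.pi := by
    simp [abs_of_pos Real.pi_pos]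
  rw [jumpDensity, norm_div, norm_div, h1, h2]
  exact div_le_self (by positivity) (by linarith [Real.pi_gt_three])

theorem continuous_jumpDensity {q : ℂ → ℂ} (hq : DifferentiableOn ℂ q nonRealPlane) {r : ℝ}
    (hr : r ≠ 0) : Continuous (jumpDensity q r) :=
  ((continuous_jump hq hr).div (by fun_prop) one_add_ofReal_sq_ne_zero).div_const _

theorem integrable_jumpDensity {q : ℂ → ℂ} (hq : DifferentiableOn ℂ q nonRealPlane) {r : ℝ}
    (hr : r ≠ 0) (hfin : jumpIntegral q r < ∞) :
    Integrable (jumpDensity q r) ∧ ∫ t, ‖jumpDensity q r t‖ ≤ (jumpIntegral q r).toReal := by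
  have hle : ∫⁻ t, ENNReal.ofReal ‖jumpDensity q r t‖ ≤ jumpIntegral q r :=
    lintegral_mono fun t => ENNReal.ofReal_le_ofReal (norm_jumpDensity_le q r t)
  have hm := (continuous_jumpDensity hq hr).aestronglyMeasurable (μ := volume)
  refine ⟨⟨hm, ?_⟩, ?_⟩
  · rw [hasFiniteIntegral_iff_norm]
    exact hle.trans_lt hfin
  · rw [integral_eq_lintegral_of_nonneg_ae (ae_of_all _ fun t => norm_nonneg _) hm.norm]
    exact ENNReal.toReal_mono hfin.ne hle

/-- Cauchy-type representation of a shifted function by its jump. -/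
theorem exists_shift_representation {q : ℂ → ℂ} (hq : DifferentiableOn ℂ q nonRealPlane)
    {M : ℝ} (hM : 0 ≤ M) (hb : ∀ z ∈ nonRealPlane, ‖q z‖ ≤ M * ((1 + ‖z‖ ^ 2) / |z.im|))
    {r : ℝ} (hr : 0 < r) (hint : Integrable (jumpDensity q r)) :
    ∃ a b : ℂ, ∀ z : ℂ, z.im ≠ 0 →
      q (awayShift r z) = a + b * z + (1 + z ^ 2) * ∫ t, resolventBCF z t * jumpDensity q r t := by
  set P := q (I + I * r) with hP
  set N := q (-I - I * r) with hN
  -- One affine function interpolates at both i and -i, so it cancels when the boundary values from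
  -- above and below are subtracted.
  obtain ⟨a, b, ha, hb'⟩ : ∃ a b : ℂ, a + b * I = P ∧ a - b * I = N := by
    refine ⟨(P + N) / 2, (P - N) / (2 * I), ?_, ?_⟩ <;> field_simp <;> ring
  refine ⟨a, b, fun z hz => ?_⟩
  have hnegI : ¬ (0 : ℝ) < (-I).im := by simp
  -- At ±i the factor 1+z² vanishes and the claim is the interpolation itself.
  by_cases h1 : z = I
  · subst h1
    simp [awayShift, ← hP, ← ha]
  by_cases h2 : z = -I
  · subst h2
    rw [awayShift, if_neg hnegI, ← hN, ← hb']
    simp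
    ring
  have hz2 := one_add_sq_ne_zero h1 h2
  have hq' : DifferentiableOn ℂ (fun t => q (-t)) {t | 0 < t.im} :=
    hq.comp (by fun_prop) fun t ht => by
      have h : 0 < t.im := ht
      show (-t).im ≠ 0
      simpa using h.ne'
  have L1 := tendsto_interpolation_upper (hq.mono fun t ht => ne_of_gt ht) hM
    (fun t ht => hb t ht.ne') hr ha hz h1
  -- The lower half-plane is reduced to the upper one by t ↦ -t.
  have L2 := tendsto_interpolation_upper (p := fun t => q (-t)) (a := a) (b := -b) (z := -z) hq' hM
    (fun t ht => by
      have := hb (-t) (show (-t).im ≠ 0 by simpa using ht.ne')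
      simpa using this) hr (by
      have : -(I + I * (r : ℂ)) = -I - I * r := by ring
      rw [this, ← hN, ← hb']
      ring) (by simpa using hz) (fun h => h2 (by rw [← h, neg_neg]))
  -- Exactly one of z and -z lies in the upper half-plane, so only one of the two Cauchy integrals
  -- contributes.
  have hlim : (if 0 < z.im then 2 * Real.pi * I * ((q (z + I * r) - (a + b * z)) / (1 + z ^ 2))
        else 0) + (if 0 < (-z).im then 2 * Real.pi * I *
          ((q (-(-z + I * r)) - (a + -b * -z)) / (1 + (-z) ^ 2)) else 0) =
      2 * Real.pi * I * ((q (awayShift r z) - (a + b * z)) / (1 + z ^ 2)) := by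
    rw [awayShift]
    rcases lt_or_gt_of_ne hz with h | h
    · have h' : 0 < (-z).im := by simpa using h
      have e : -(-z + I * (r : ℂ)) = z - I * r := by ring
      rw [if_neg h.not_gt, if_neg h.not_gt, if_pos h', e, neg_mul_neg, neg_sq, zero_add]
    · have h' : ¬ 0 < (-z).im := by simpa using h.le
      rw [if_pos h, if_pos h, if_neg h', add_zero]
  have hsum := L1.add L2
  rw [hlim] at hsum
  have hcube : Tendsto (fun s : ℝ => s ^ 3) atTop atTop := tendsto_pow_atTop (by norm_num)
  have hRint : Integrable fun t => resolventBCF z t * jumpDensity q r t :=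
    hint.bdd_mul (resolventBCF z).continuous.aestronglyMeasurable
      (ae_of_all _ (resolventBCF z).norm_coe_le_norm)
  have hfull := (intervalIntegral_tendsto_integral hRint
    (tendsto_neg_atTop_atBot.comp hcube) hcube).const_mul (2 * Real.pi * I)
  have hcl : Continuous fun t : ℝ => (1 + (t : ℂ) ^ 2) := by fun_prop
  have hcd : Continuous fun t : ℝ => (t : ℂ) - z := by fun_prop
  have c1 : Continuous fun t : ℝ =>
      (q ((t : ℂ) + I * r) - (a + b * t)) / (1 + (t : ℂ) ^ 2) / ((t : ℂ) - z) :=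
    (((continuous_line hq hr.ne').sub (by fun_prop)).div hcl one_add_ofReal_sq_ne_zero).div hcd
      (ofReal_sub_ne_zero hz)
  have c2 : Continuous fun t : ℝ =>
      (q ((t : ℂ) - I * r) - (a + b * t)) / (1 + (t : ℂ) ^ 2) / ((t : ℂ) - z) := by
    have := continuous_line hq (neg_ne_zero.2 hr.ne')
    simp only [ofReal_neg, mul_neg, ← sub_eq_add_neg] at this
    exact ((this.sub (by fun_prop)).div hcl one_add_ofReal_sq_ne_zero).div hcd
      (ofReal_sub_ne_zero hz)
  have hpt : ∀ s : ℝ,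
      (∫ t in (-s ^ 3)..(s ^ 3),
        (q ((t : ℂ) + I * r) - (a + b * t)) / (1 + (t : ℂ) ^ 2) / ((t : ℂ) - z)) +
      (∫ t in (-s ^ 3)..(s ^ 3),
        (q (-((t : ℂ) + I * r)) - (a + -b * t)) / (1 + (t : ℂ) ^ 2) / ((t : ℂ) - -z)) =
      2 * Real.pi * I * ∫ t in (-s ^ 3)..(s ^ 3), resolventBCF z t * jumpDensity q r t := fun s => by
    have e2 : ∫ t in (-s ^ 3)..(s ^ 3),
        (q (-((t : ℂ) + I * r)) - (a + -b * t)) / (1 + (t : ℂ) ^ 2) / ((t : ℂ) - -z) =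
        ∫ t in (-s ^ 3)..(s ^ 3),
          -((q ((t : ℂ) - I * r) - (a + b * t)) / (1 + (t : ℂ) ^ 2) / ((t : ℂ) - z)) := by
      have := intervalIntegral.integral_comp_neg (a := -s ^ 3) (b := s ^ 3)
        (fun t : ℝ => -((q ((t : ℂ) - I * r) - (a + b * t)) / (1 + (t : ℂ) ^ 2) / ((t : ℂ) - z)))
      rw [neg_neg] at this
      rw [← this]
      refine intervalIntegral.integral_congr fun t _ => ?_
      simp only [ofReal_neg]
      have e3 : -((t : ℂ) + I * r) = -t - I * r := by ring
      have e4 : -(t : ℂ) - z = -((t : ℂ) - -z) := by ring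
      rw [e3, e4, neg_sq, div_neg, neg_neg]
      ring
    have c3 : Continuous fun t : ℝ =>
        -((q ((t : ℂ) - I * r) - (a + b * t)) / (1 + (t : ℂ) ^ 2) / ((t : ℂ) - z)) := c2.neg
    rw [e2, ← intervalIntegral.integral_add (c1.intervalIntegrable _ _)
      (c3.intervalIntegrable _ _), ← intervalIntegral.integral_const_mul]
    refine intervalIntegral.integral_congr fun t _ => ?_
    have n1 := two_pi_I_ne_zero
    rw [resolventBCF_apply hz, jumpDensity]
    field_simp
    ring
  have huniq := tendsto_nhds_unique (hsum.congr hpt) hfull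
  have huniq' := mul_left_cancel₀ two_pi_I_ne_zero huniq
  rw [← huniq']
  field_simp
  ring

/-! ### Sufficiency: positive parts and the limit r → 0+ -/

/-- The positive part of the real part of a complex function. -/
noncomputable def rePosPart (c : ℝ → ℂ) (t : ℝ) : ℝ := max (c t).re 0

theorem rePosPart_nonneg (c : ℝ → ℂ) (t : ℝ) : 0 ≤ rePosPart c t := le_max_right _ _

theorem integrable_rePosPart {c : ℝ → ℂ} (hc : Integrable c) : Integrable (rePosPart c) :=
  hc.re.pos_part

theorem integral_rePosPart_le {c : ℝ → ℂ} (hc : Integrable c) :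
    ∫ t, rePosPart c t ≤ ∫ t, ‖c t‖ :=
  integral_mono (integrable_rePosPart hc) hc.norm fun _ =>
    max_le ((le_abs_self _).trans (abs_re_le_norm _)) (norm_nonneg _)

theorem rePosPart_decomposition (c : ℝ → ℂ) (t : ℝ) :
    c t = (rePosPart c t - rePosPart (fun t => -c t) t) +
      I * (rePosPart (fun t => -I * c t) t - rePosPart (fun t => I * c t) t) := by
  apply Complex.ext <;> simp [rePosPart]

theorem integral_mul_decomposition {c : ℝ → ℂ} (hc : Integrable c) (φ : ℝ →ᵇ ℂ) :
    ∫ t, φ t * c t = ((∫ t, φ t * rePosPart c t) - ∫ t, φ t * rePosPart (fun t => -c t) t) +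
      I * ((∫ t, φ t * rePosPart (fun t => -I * c t) t) -
        ∫ t, φ t * rePosPart (fun t => I * c t) t) := by
  have i1 := integrable_mul_weight (integrable_rePosPart hc) φ
  have hn : Integrable fun t => -c t := hc.neg
  have i2 := integrable_mul_weight (integrable_rePosPart hn) φ
  have i3 := integrable_mul_weight (integrable_rePosPart (hc.const_mul (-I))) φ
  have i4 := integrable_mul_weight (integrable_rePosPart (hc.const_mul I)) φ
  have s1 : Integrable fun t =>
      φ t * rePosPart c t - φ t * rePosPart (fun t => -c t) t := i1.sub i2
  have s2 : Integrable fun t =>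
      φ t * rePosPart (fun t => -I * c t) t - φ t * rePosPart (fun t => I * c t) t := i3.sub i4
  rw [← integral_sub i3 i4, ← integral_const_mul, ← integral_sub i1 i2,
    ← integral_add s1 (s2.const_mul I)]
  refine integral_congr_ae (ae_of_all _ fun t => ?_)
  have := rePosPart_decomposition c t
  simp only
  conv_lhs => rw [this]
  ring

theorem integral_herglotzKernel_mul {c : ℝ → ℂ} (hc : Integrable c) {z : ℂ} :
    ∫ t, herglotzKernel z t * c t =
      z * (∫ t, c t) + (1 + z ^ 2) * ∫ t, resolventBCF z t * c t := by
  have hR : Integrable fun t => resolventBCF z t * c t :=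
    hc.bdd_mul (resolventBCF z).continuous.aestronglyMeasurable
      (ae_of_all _ (resolventBCF z).norm_coe_le_norm)
  rw [← integral_const_mul, ← integral_const_mul,
    ← integral_add (hc.const_mul z) (hR.const_mul _)]
  refine integral_congr_ae (ae_of_all _ fun t => ?_)
  have h2 : (1 : ℝ →ᵇ ℂ) t = 1 := rfl
  simp only [herglotzKernel, BoundedContinuousFunction.add_apply,
    BoundedContinuousFunction.smul_apply, h2, smul_eq_mul]
  ring

/-- An affine function is determined by its values at ±i, so convergence there identifies the limit
everywhere. No separate bound on the coefficients is needed. -/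
theorem eq_affine_of_tendsto {ι : Type*} {l : Filter ι} [l.NeBot] {S : Set ℂ} {A B : ι → ℂ}
    {G : ℂ → ℂ} (hI : I ∈ S) (hnI : -I ∈ S)
    (h : ∀ z ∈ S, Tendsto (fun i => A i + B i * z) l (𝓝 (G z))) :
    ∃ a b : ℂ, ∀ z ∈ S, G z = a + b * z := by
  refine ⟨G I - I * ((G I - G (-I)) / (2 * I)), (G I - G (-I)) / (2 * I), fun z hz => ?_⟩
  have h1 := (h I hI).add ((((h I hI).sub (h (-I) hnI)).div_const (2 * I)).const_mul (z - I))
  refine (tendsto_nhds_unique ((h z hz).congr fun i => ?_) h1).trans ?_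
  · field_simp
    ring
  · ring

theorem tendsto_awayShift (z : ℂ) : Tendsto (fun r : ℝ => awayShift r z) (𝓝 0) (𝓝 z) := by
  unfold awayShift
  split_ifs
  · have : Continuous fun r : ℝ => z + I * r := by fun_prop
    simpa using this.tendsto 0
  · have : Continuous fun r : ℝ => z - I * r := by fun_prop
    simpa using this.tendsto 0

theorem IsHerglotz.add_affine {h : ℂ → ℂ} (hh : IsHerglotz h) (x : ℝ) {y : ℝ} (hy : 0 ≤ y) :
    IsHerglotz fun z => h z + (x + y * z) where
  holomorphic := hh.holomorphic.add (by fun_prop)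
  im_div_im_nonneg z hz := by
    have h0 : z.im ≠ 0 := hz
    have h1 := hh.im_div_im_nonneg z hz
    have e : (h z + (x + y * z)).im / z.im = (h z).im / z.im + y := by
      simp [add_div, h0]
    rw [e]
    positivity
  conj_symm z hz := by
    simp [hh.conj_symm z hz]

/-- Real constants and nonnegative multiples of z are Herglotz; the slope is split into positive and
negative parts of its real and imaginary parts. -/
theorem isQuasiHerglotz_of_affine {q h₁ h₂ h₃ h₄ : ℂ → ℂ} (H₁ : IsHerglotz h₁)
    (H₂ : IsHerglotz h₂) (H₃ : IsHerglotz h₃) (H₄ : IsHerglotz h₄) (a b : ℂ)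
    (e : ∀ z ∈ nonRealPlane, q z - ((h₁ z - h₂ z) + I * (h₃ z - h₄ z)) = a + b * z) :
    IsQuasiHerglotz q := by
  refine ⟨_, _, _, _, H₁.add_affine a.re (le_max_right b.re 0),
    H₂.add_affine 0 (le_max_right (-b.re) 0), H₃.add_affine a.im (le_max_right b.im 0),
    H₄.add_affine 0 (le_max_right (-b.im) 0), fun z hz => ?_⟩
  have h : ∀ x : ℝ, ((max x 0 : ℝ) : ℂ) - ((max (-x) 0 : ℝ) : ℂ) = x := fun x => by
    rcases le_total x 0 with h | h
    · rw [max_eq_right h, max_eq_left (by linarith)]; push_cast; ring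
    · rw [max_eq_left h, max_eq_right (by linarith)]; push_cast; ring
  simp only [ofReal_zero, zero_add]
  linear_combination e z hz - z * h b.re - I * z * h b.im - re_add_im a - z * re_add_im b

theorem isQuasiHerglotz_of_growth_of_jump {q : ℂ → ℂ} (hq : DifferentiableOn ℂ q nonRealPlane)
    {M : ℝ} (hM : 0 ≤ M) (hb : ∀ z ∈ nonRealPlane, ‖q z‖ ≤ M * ((1 + ‖z‖ ^ 2) / |z.im|))
    (hreg : (⨆ r ∈ Set.Ioo (0 : ℝ) 1, jumpIntegral q r) < ∞) : IsQuasiHerglotz q := by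
  set B := ⨆ r ∈ Set.Ioo (0 : ℝ) 1, jumpIntegral q r with hB
  have hJ : ∀ r ∈ Set.Ioo (0 : ℝ) 1, Integrable (jumpDensity q r) ∧
      ∫ t, ‖jumpDensity q r t‖ ≤ B.toReal := fun r hr => by
    have hle : jumpIntegral q r ≤ B := le_iSup₂ (f := fun r (_ : r ∈ Set.Ioo (0 : ℝ) 1) =>
      jumpIntegral q r) r hr
    obtain ⟨h1, h2⟩ := integrable_jumpDensity hq hr.1.ne' (hle.trans_lt hreg)
    exact ⟨h1, h2.trans (ENNReal.toReal_mono hreg.ne hle)⟩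
  have hrep : ∀ r : ℝ, ∃ a b : ℂ, r ∈ Set.Ioo (0 : ℝ) 1 → ∀ z : ℂ, z.im ≠ 0 →
      q (awayShift r z) = a + b * z + (1 + z ^ 2) * ∫ t, resolventBCF z t * jumpDensity q r t := by
    intro r
    by_cases hr : r ∈ Set.Ioo (0 : ℝ) 1
    · obtain ⟨a, b, h⟩ := exists_shift_representation hq hM hb hr.1 (hJ r hr).1
      exact ⟨a, b, fun _ => h⟩
    · exact ⟨0, 0, fun h => (hr h).elim⟩
  choose a b hab using hrep
  set U : Ultrafilter ℝ := Ultrafilter.of (𝓝[>] (0 : ℝ)) with hU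
  have hUle : (U : Filter ℝ) ≤ 𝓝[>] (0 : ℝ) := Ultrafilter.of_le _
  have hev : ∀ᶠ r in U, r ∈ Set.Ioo (0 : ℝ) 1 := hUle (Ioo_mem_nhdsGT one_pos)
  have hpart : ∀ u : ℂ, ‖u‖ = 1 → ∃ Λ : (ℝ →ᵇ ℂ) →L[ℂ] ℂ, IsPositiveFunctional Λ ∧
      ∀ φ : ℝ →ᵇ ℂ, Tendsto (fun r => ∫ t, φ t * rePosPart (fun t => u * jumpDensity q r t) t) U
        (𝓝 (Λ φ)) := fun u hu => by
    refine exists_tendsto_weight (C := B.toReal) U ?_ (fun r t => rePosPart_nonneg _ t) ?_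
    · filter_upwards [hev] with r hr
      exact integrable_rePosPart ((hJ r hr).1.const_mul u)
    · filter_upwards [hev] with r hr
      refine (integral_rePosPart_le ((hJ r hr).1.const_mul u)).trans ?_
      simp_rw [norm_mul, hu, one_mul]
      exact (hJ r hr).2
  obtain ⟨Λ₁, P₁, T₁⟩ := hpart 1 (by simp)
  obtain ⟨Λ₂, P₂, T₂⟩ := hpart (-1) (by simp)
  obtain ⟨Λ₃, P₃, T₃⟩ := hpart (-I) (by simp)
  obtain ⟨Λ₄, P₄, T₄⟩ := hpart I (by simp)
  simp only [one_mul, neg_one_mul] at T₁ T₂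
  obtain ⟨α, β, hαβ⟩ := eq_affine_of_tendsto (l := (U : Filter ℝ)) (S := nonRealPlane)
    -- The Herglotz kernel equals z plus (1+z²) times the resolvent, so replacing one kernel by the
    -- other changes only the slope.
    (A := a) (B := fun r => b r - ∫ t, jumpDensity q r t)
    (G := fun z => q z - ((Λ₁ (herglotzKernel z) - Λ₂ (herglotzKernel z)) +
      I * (Λ₃ (herglotzKernel z) - Λ₄ (herglotzKernel z))))
    (show I.im ≠ 0 by simp) (show (-I).im ≠ 0 by simp) (fun z hz => by
      have hopen : IsOpen nonRealPlane := isOpen_ne_fun continuous_im continuous_const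
      have hqc : Tendsto (fun r : ℝ => q (awayShift r z)) U (𝓝 (q z)) :=
        ((hq.continuousOn.continuousAt (hopen.mem_nhds hz)).tendsto.comp
          (tendsto_awayShift z)).mono_left (hUle.trans nhdsWithin_le_nhds)
      refine (hqc.sub (((T₁ (herglotzKernel z)).sub (T₂ _)).add
        (((T₃ _).sub (T₄ _)).const_mul I))).congr' ?_
      filter_upwards [hev] with r hr
      have hi := (hJ r hr).1
      rw [hab r hr z hz, ← integral_mul_decomposition hi, integral_herglotzKernel_mul hi]
      ring)
  exact isQuasiHerglotz_of_affine P₁.isHerglotz P₂.isHerglotz P₃.isHerglotz P₄.isHerglotz α β hαβ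

theorem mainTheorem2 (q : ℂ → ℂ) (hq : DifferentiableOn ℂ q nonRealPlane) :
    IsQuasiHerglotz q ↔
      (∃ M : ℝ, 0 ≤ M ∧ ∀ z ∈ nonRealPlane, ‖q z‖ ≤ M * ((1 + ‖z‖ ^ 2) / |z.im|)) ∧
      (⨆ r ∈ Set.Ioo (0 : ℝ) 1,
        ∫⁻ t : ℝ, ENNReal.ofReal
          (‖q ((t : ℂ) + Complex.I * (r : ℂ)) - q ((t : ℂ) - Complex.I * (r : ℂ))‖
            / (1 + t ^ 2))) < ∞ := by
  refine ⟨fun h => ⟨h.exists_growth, h.iSup_jumpIntegral_lt_top⟩, ?_⟩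
  rintro ⟨⟨M, hM, hb⟩, hreg⟩
  exact isQuasiHerglotz_of_growth_of_jump hq hM hb hreg
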